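/- **Definitions.** A *form* over a category $\mathbb{C}$ is a functor $F\colon\mathbb{B}\to\mathbb{C}$ which is faithful and amnestic (the only isomorphisms mapped to identity morphisms are the identity morphisms). Objects of $\mathbb{B}$ mapped to $X$ are called *clusters* in $X$. For $f\colon X\to Y$ and clusters $S$ in $X$ and $T$ in $Y$, write $T\geq_f S$ if there is a morphism $S\to T$ in $\mathbb{B}$ mapped to $f$; the clusters in $X$ are partially ordered by $\geq_{1_X}$. The form $F$ is *orean* if (O1) for each $X$ the poset of clusters in $X$ is a bounded lattice; (O2) whenever $T\geq_{gf}R$ (with $f\colon X\to Y$ and $g\colon Y\to Z$), there is a cluster $S$ in $Y$ with $T\geq_g S\geq_f R$; (O3) for each $f\colon X\to Y$ and cluster $S$ in $X$ there is a smallest $T$ with $T\geq_f S$, denoted $f\cdot S$, and for each cluster $T$ in $Y$ there is a largest $S$ with $T\geq_f S$, denoted $T\cdot f$. For $f\colon X\to Y$ put $\operatorname{im}f=f\cdot\top_X$ and $\ker f=\bot_Y\cdot f$. A cluster is *conormal* if it is the image of some morphism, and *normal* if it is the kernel of some morphism. An orean form is *conormal* (*normal*) if all of its clusters are, and *binormal*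 if it is both. An *embedding* of a conormal cluster $S$ in $X$ is a morphism $m$ to $X$ with $\operatorname{im}m=S$ such that each $f$ to $X$ with $\operatorname{im}f\leq S$ factors uniquely as $f=mg$. Dually, a *quotient* of a normal cluster $S$ in $X$ is a morphism $e$ from $X$ with $\ker e=S$ such that each $f$ from $X$ with $\ker f\geq S$ factors uniquely as $f=ge$. A *noetherian form* is an orean form such that (N1) $(f\cdot S)\cdot f=S\vee\ker f$ and $f\cdot(T\cdot f)=T\wedge\operatorname{im}f$ for all $f\colon X\to Y$ and clusters $S$ in $X$, $T$ in $Y$; (N2) each morphism $f$ is a composite $f=me$ of a quotient $e$ of $\ker f$ and an embedding $m$ of $\operatorname{im}f$; (N3) joins of two normal clusters are normal and meets of two conormal clusters are conormal. An *operator* from a form $F\colon\mathbb{A}\to\mathbb{C}$ to a form $G\colon\mathbb{B}\to\mathbb{C}$ is a functor $\tau\colon\mathbb{A}\to\mathbb{B}$ with $G\tau=F$. Between orean forms, $\tau$ is *conormal* if $\tau(\operatorname{im}^F f)=\operatorname{im}^G f$ for all $f$, *normal* if $\tau(\ker^F f)=\ker^G f$ for all $f$, and *binormal* if it is both. For an operator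 $\kappa$ from $F$ to $F$ that is idempotent ($\kappa\kappa=\kappa$), $F_\kappa$ is the restriction of $F$ to the full subcategory of those clusters $S$ with $\kappa S=S$. A *decomposition* of an orean form $F$ is a pair $(\kappa_{\mathsf s},\kappa_{\mathsf e})$ of idempotent operators on $F$ such that $F_{\mathsf s}=F_{\kappa_{\mathsf s}}$ is a conormal orean form, $F_{\mathsf e}=F_{\kappa_{\mathsf e}}$ is a normal orean form, and for some binary term $\mathfrak{t}$ in the theory of bounded lattices, $S=\mathfrak{t}(\kappa_{\mathsf s}S,\kappa_{\mathsf e}S)$ for all clusters $S$. It is *exact* if the restrictions $F\to F_{\mathsf s}$ of $\kappa_{\mathsf s}$ and $F\to F_{\mathsf e}$ of $\kappa_{\mathsf e}$ are binormal, there exist a conormal operator $F_{\mathsf s}\to F_{\mathsf e}$ and a normal operator $F_{\mathsf e}\to F_{\mathsf s}$, and the inclusion $F_{\mathsf s}\to F$ is conormal and the inclusion $F_{\mathsf e}\to F$ is normal. It is an exact *join* (*meet*) decomposition if one can take $\mathfrak{t}(x,y)=x\vee y$ (respectively $\mathfrak{t}(x,y)=x\wedge y$). An *emd-noetherian form* is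 a noetherian form that has an exact meet decomposition. A category is *pointed* if it has a zero object. **Theorem.** For a category $\mathbb{C}$ having finite products and finite sums (coproducts), the following conditions are equivalent: (i) there is a binormal noetherian form over $\mathbb{C}$; (ii) there is a binormal noetherian form over $\mathbb{C}$ which has an exact decomposition; (iii) there is an emd-noetherian form over $\mathbb{C}$ which has an exact join decomposition; (iv) $\mathbb{C}$ is pointed and there is a normal emd-noetherian form over $\mathbb{C}$; (v) $\mathbb{C}$ is an abelian category. -/

import Mathlib

open CategoryTheory CategoryTheory.Limits

universe v u v₁ u₁ v₂ u₂ w t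

namespace Forms

variable {C : Type u} [Category.{v} C]
variable {A : Type u₁} [Category.{v₁} A] {B : Type u₂} [Category.{v₂} B]

/-! ### Forms and clusters -/

/-- A form over `C` is a functor `F` to `C` that is faithful and amnestic: the only isomorphisms
that lie over identity morphisms are the identity morphisms. -/
class IsForm (F : B ⥤ C) : Prop where
  faithful : F.Faithful
  amnestic : ∀ {S T : B} (φ : S ⟶ T) [IsIso φ],
    F.IsHomLift (𝟙 (F.obj S)) φ → ∃ h : S = T, φ = eqToHom h

/-- The clusters in an object `X`: the objects of the domain that lie over `X`. -/
@[ext]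
structure Cluster (F : B ⥤ C) (X : C) : Type u₂ where
  obj : B
  obj_eq : F.obj obj = X

/-- `Rel F f S T` is the relation `T ≥_f S`: there is a morphism `S ⟶ T` lying over `f`. -/
def Rel (F : B ⥤ C) {X Y : C} (f : X ⟶ Y) (S : Cluster F X) (T : Cluster F Y) : Prop :=
  ∃ φ : S.obj ⟶ T.obj, F.IsHomLift f φ

section Order

variable (F : B ⥤ C)

theorem Rel.refl {X : C} (S : Cluster F X) : Rel F (𝟙 X) S S :=
  ⟨𝟙 S.obj, IsHomLift.id S.obj_eq⟩

variable {F} in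
theorem Rel.comp {X Y Z : C} {f : X ⟶ Y} {g : Y ⟶ Z} {R : Cluster F X} {S : Cluster F Y}
    {T : Cluster F Z} (h₁ : Rel F f R S) (h₂ : Rel F g S T) : Rel F (f ≫ g) R T := by
  obtain ⟨φ, hφ⟩ := h₁
  obtain ⟨ψ, hψ⟩ := h₂
  exact ⟨φ ≫ ψ, inferInstance⟩

variable {F} in
theorem Rel.antisymm [hF : IsForm F] {X : C} {S T : Cluster F X} (h₁ : Rel F (𝟙 X) S T)
    (h₂ : Rel F (𝟙 X) T S) : S = T := by
  obtain ⟨S, rfl⟩ := S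
  obtain ⟨T, hT⟩ := T
  obtain ⟨φ, hφ⟩ := h₁
  obtain ⟨ψ, hψ⟩ := h₂
  dsimp only at φ ψ
  have := hF.faithful
  have e₁ := IsHomLift.fac' F (𝟙 (F.obj S)) φ
  have e₂ := IsHomLift.fac' F (𝟙 (F.obj S)) ψ
  have : IsIso φ := ⟨ψ, F.map_injective (by simp [e₁, e₂]), F.map_injective (by simp [e₁, e₂])⟩
  exact Cluster.ext (hF.amnestic φ hφ).choose

/-- The clusters in `X` are ordered by the relation `T ≥_f S` for `f` the identity of `X`. -/
instance [IsForm F] (X : C) : PartialOrder (Cluster F X) where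
  le S T := Rel F (𝟙 X) S T
  le_refl S := Rel.refl F S
  le_trans _ _ _ h₁ h₂ := by simpa using Rel.comp h₁ h₂
  le_antisymm _ _ := Rel.antisymm

end Order

/-! ### Orean forms -/

/-- A form is orean when its posets of clusters are bounded lattices, it satisfies the converse of
the composition law for the relations `≥_f`, and it has direct and inverse images. -/
class IsOrean (F : B ⥤ C) : Prop extends IsForm F where
  exists_bot : ∀ X : C, ∃ S : Cluster F X, IsLeast Set.univ S
  exists_top : ∀ X : C, ∃ S : Cluster F X, IsGreatest Set.univ S
  exists_sup : ∀ {X : C} (S T : Cluster F X), ∃ U, IsLUB {S, T} U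
  exists_inf : ∀ {X : C} (S T : Cluster F X), ∃ U, IsGLB {S, T} U
  exists_mid : ∀ {X Y Z : C} (f : X ⟶ Y) (g : Y ⟶ Z) (R : Cluster F X) (T : Cluster F Z),
    Rel F (f ≫ g) R T → ∃ S : Cluster F Y, Rel F f R S ∧ Rel F g S T
  exists_direct : ∀ {X Y : C} (f : X ⟶ Y) (S : Cluster F X),
    ∃ T : Cluster F Y, IsLeast {T | Rel F f S T} T
  exists_inverse : ∀ {X Y : C} (f : X ⟶ Y) (T : Cluster F Y),
    ∃ S : Cluster F X, IsGreatest {S | Rel F f S T} S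

section Orean

variable (F : B ⥤ C) [hF : IsOrean F]

noncomputable instance (X : C) : Lattice (Cluster F X) where
  sup S T := (hF.exists_sup S T).choose
  inf S T := (hF.exists_inf S T).choose
  le_sup_left S T := (hF.exists_sup S T).choose_spec.1 (by simp)
  le_sup_right S T := (hF.exists_sup S T).choose_spec.1 (by simp)
  sup_le S T U h₁ h₂ := (hF.exists_sup S T).choose_spec.2 (by
    rintro _ (rfl | rfl)
    exacts [h₁, h₂])
  inf_le_left S T := (hF.exists_inf S T).choose_spec.1 (by simp)
  inf_le_right S T := (hF.exists_inf S T).choose_spec.1 (by simp)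
  le_inf S T U h₁ h₂ := (hF.exists_inf T U).choose_spec.2 (by
    rintro _ (rfl | rfl)
    exacts [h₁, h₂])

noncomputable instance (X : C) : BoundedOrder (Cluster F X) where
  top := (hF.exists_top X).choose
  bot := (hF.exists_bot X).choose
  le_top S := (hF.exists_top X).choose_spec.2 (Set.mem_univ S)
  bot_le S := (hF.exists_bot X).choose_spec.2 (Set.mem_univ S)

variable {X Y : C}

/-- The direct image `f · S`: the smallest `T` with `T ≥_f S`. -/
noncomputable def direct (f : X ⟶ Y) (S : Cluster F X) : Cluster F Y :=
  (hF.exists_direct f S).choose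

/-- The inverse image `T · f`: the largest `S` with `T ≥_f S`. -/
noncomputable def inverse (f : X ⟶ Y) (T : Cluster F Y) : Cluster F X :=
  (hF.exists_inverse f T).choose

theorem isLeast_direct (f : X ⟶ Y) (S : Cluster F X) :
    IsLeast {T | Rel F f S T} (direct F f S) :=
  (hF.exists_direct f S).choose_spec

theorem isGreatest_inverse (f : X ⟶ Y) (T : Cluster F Y) :
    IsGreatest {S | Rel F f S T} (inverse F f T) :=
  (hF.exists_inverse f T).choose_spec

/-- The image of a morphism. -/
noncomputable def im (f : X ⟶ Y) : Cluster F Y := direct F f ⊤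

/-- The kernel of a morphism. -/
noncomputable def ker (f : X ⟶ Y) : Cluster F X := inverse F f ⊥

/-- A conormal cluster is the image of some morphism. -/
def IsConormalCluster (S : Cluster F X) : Prop := ∃ (W : C) (f : W ⟶ X), S = im F f

/-- A normal cluster is the kernel of some morphism. -/
def IsNormalCluster (S : Cluster F X) : Prop := ∃ (Y : C) (g : X ⟶ Y), S = ker F g

/-- A conormal form: every cluster is conormal. -/
def IsConormalForm : Prop := ∀ (X : C) (S : Cluster F X), IsConormalCluster F S

/-- A normal form: every cluster is normal. -/
def IsNormalForm : Prop := ∀ (X : C) (S : Cluster F X), IsNormalCluster F S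

/-- A binormal form is both normal and conormal. -/
def IsBinormalForm : Prop := IsNormalForm F ∧ IsConormalForm F

/-! ### Noetherian forms -/

/-- `m` is an embedding of the (then necessarily conormal) cluster `S`: its image is `S`, and every
morphism whose image is below `S` factors uniquely through `m`. -/
def IsEmbedding {M : C} (m : M ⟶ X) (S : Cluster F X) : Prop :=
  im F m = S ∧ ∀ {W : C} (f : W ⟶ X), im F f ≤ S → ∃! g : W ⟶ M, g ≫ m = f

/-- `e` is a quotient of the (then necessarily normal) cluster `S`: its kernel is `S`, and every
morphism whose kernel is above `S` factors uniquely through `e`. -/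
def IsQuotient {Q : C} (e : X ⟶ Q) (S : Cluster F X) : Prop :=
  ker F e = S ∧ ∀ {W : C} (f : X ⟶ W), S ≤ ker F f → ∃! g : Q ⟶ W, e ≫ g = f

end Orean

/-- A noetherian form: an orean form satisfying the axioms (N1), (N2) and (N3). -/
class IsNoetherianForm (F : B ⥤ C) : Prop extends IsOrean F where
  inverse_direct : ∀ {X Y : C} (f : X ⟶ Y) (S : Cluster F X),
    inverse F f (direct F f S) = S ⊔ ker F f
  direct_inverse : ∀ {X Y : C} (f : X ⟶ Y) (T : Cluster F Y),
    direct F f (inverse F f T) = T ⊓ im F f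
  factorization : ∀ {X Y : C} (f : X ⟶ Y), ∃ (Z : C) (e : X ⟶ Z) (m : Z ⟶ Y),
    IsQuotient F e (ker F f) ∧ IsEmbedding F m (im F f) ∧ e ≫ m = f
  normal_sup : ∀ {X : C} (S T : Cluster F X), IsNormalCluster F S → IsNormalCluster F T →
    IsNormalCluster F (S ⊔ T)
  conormal_inf : ∀ {X : C} (S T : Cluster F X), IsConormalCluster F S → IsConormalCluster F T →
    IsConormalCluster F (S ⊓ T)

/-! ### Operators -/

/-- An operator `F → G` between forms over `C`: a functor `τ` with `G ∘ τ = F`. -/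
structure Operator (F : A ⥤ C) (G : B ⥤ C) where
  functor : A ⥤ B
  comp_eq : functor ⋙ G = F

namespace Operator

/-- The action of an operator on clusters. -/
def app {F : A ⥤ C} {G : B ⥤ C} (τ : Operator F G) {X : C} (S : Cluster F X) : Cluster G X :=
  ⟨τ.functor.obj S.obj, (Functor.congr_obj τ.comp_eq S.obj).trans S.obj_eq⟩

/-- A conormal operator between orean forms preserves images. -/
def IsConormal {F : A ⥤ C} {G : B ⥤ C} [IsOrean F] [IsOrean G] (τ : Operator F G) : Prop :=
  ∀ {X Y : C} (f : X ⟶ Y), τ.app (im F f) = im G f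

/-- A normal operator between orean forms preserves kernels. -/
def IsNormal {F : A ⥤ C} {G : B ⥤ C} [IsOrean F] [IsOrean G] (τ : Operator F G) : Prop :=
  ∀ {X Y : C} (f : X ⟶ Y), τ.app (ker F f) = ker G f

/-- A binormal operator is both normal and conormal. -/
def IsBinormal {F : A ⥤ C} {G : B ⥤ C} [IsOrean F] [IsOrean G] (τ : Operator F G) : Prop :=
  τ.IsNormal ∧ τ.IsConormal

variable {F : B ⥤ C} (κ : Operator F F)

/-- An idempotent operator. -/
def IsIdempotent : Prop := κ.functor ⋙ κ.functor = κ.functor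

/-- The property of being a `κ`-closed cluster. -/
def IsClosed : ObjectProperty B := fun S ↦ κ.functor.obj S = S

/-- The subform `F_κ` of `F` that consists of the `κ`-closed clusters. -/
def closedForm : κ.IsClosed.FullSubcategory ⥤ C := κ.IsClosed.ι ⋙ F

/-- The subform inclusion `F_κ → F`. -/
def inclusion : Operator κ.closedForm F := ⟨κ.IsClosed.ι, rfl⟩

/-- The restriction `F → F_κ` of an idempotent operator `κ`. -/
def projection (h : κ.IsIdempotent) : Operator F κ.closedForm :=
  ⟨κ.IsClosed.lift κ.functor (Functor.congr_obj h), κ.comp_eq⟩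

end Operator

/-! ### Decompositions -/

/-- A semiexact pair: `F` is a conormal orean form, `G` is a normal orean form, and there are a
conormal operator `F → G` and a normal operator `G → F`. -/
structure IsSemiexactPair (F : A ⥤ C) (G : B ⥤ C) [IsOrean F] [IsOrean G] : Prop where
  conormalForm : IsConormalForm F
  normalForm : IsNormalForm G
  exists_conormal : ∃ α : Operator F G, α.IsConormal
  exists_normal : ∃ β : Operator G F, β.IsNormal

/-- Binary terms in the algebraic theory of bounded lattices. -/
inductive LatticeTerm : Type
  | fst : LatticeTerm
  | snd : LatticeTerm
  | top : LatticeTerm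
  | bot : LatticeTerm
  | sup : LatticeTerm → LatticeTerm → LatticeTerm
  | inf : LatticeTerm → LatticeTerm → LatticeTerm

/-- The interpretation of a binary term in a bounded lattice. -/
def LatticeTerm.eval {L : Type*} [Lattice L] [BoundedOrder L] (x y : L) : LatticeTerm → L
  | .fst => x
  | .snd => y
  | .top => ⊤
  | .bot => ⊥
  | .sup a b => a.eval x y ⊔ b.eval x y
  | .inf a b => a.eval x y ⊓ b.eval x y

/-- The term `x ∨ y`. -/
def LatticeTerm.join : LatticeTerm := .sup .fst .snd

/-- The term `x ∧ y`. -/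
def LatticeTerm.meet : LatticeTerm := .inf .fst .snd

/-- The pair `(κs, κe)` of operators is a decomposition of the orean form `F` with decomposing
term `d`. -/
structure IsDecomposition (F : B ⥤ C) [IsOrean F] (κs κe : Operator F F) (d : LatticeTerm) :
    Prop where
  idem_s : κs.IsIdempotent
  idem_e : κe.IsIdempotent
  orean_s : IsOrean κs.closedForm
  orean_e : IsOrean κe.closedForm
  conormal_s : IsConormalForm κs.closedForm
  normal_e : IsNormalForm κe.closedForm
  eq_eval : ∀ {X : C} (S : Cluster F X), S = d.eval (κs.app S) (κe.app S)

/-- A semiexact decomposition: both decomposition projections are binormal, and the pair of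
subforms of closed clusters is a semiexact pair. -/
structure IsSemiexactDecomposition (F : B ⥤ C) [IsOrean F] (κs κe : Operator F F)
    (d : LatticeTerm) : Prop extends IsDecomposition F κs κe d where
  binormal_s : (κs.projection idem_s).IsBinormal
  binormal_e : (κe.projection idem_e).IsBinormal
  semiexact : IsSemiexactPair κs.closedForm κe.closedForm

/-- An exact decomposition: a semiexact one where the first subform inclusion is conormal and the
second one is normal. -/
structure IsExactDecomposition (F : B ⥤ C) [IsOrean F] (κs κe : Operator F F)
    (d : LatticeTerm) : Prop extends IsSemiexactDecomposition F κs κe d where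
  inclusion_s : κs.inclusion.IsConormal
  inclusion_e : κe.inclusion.IsNormal

/-- `F` has an exact decomposition. -/
def HasExactDecomposition (F : B ⥤ C) [IsOrean F] : Prop :=
  ∃ (κs κe : Operator F F) (d : LatticeTerm), IsExactDecomposition F κs κe d

/-- `F` has an exact join decomposition, i.e. one with decomposing term `x ∨ y`. -/
def HasExactJoinDecomposition (F : B ⥤ C) [IsOrean F] : Prop :=
  ∃ κs κe : Operator F F, IsExactDecomposition F κs κe LatticeTerm.join

/-- `F` has an exact meet decomposition, i.e. one with decomposing term `x ∧ y`. -/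
def HasExactMeetDecomposition (F : B ⥤ C) [IsOrean F] : Prop :=
  ∃ κs κe : Operator F F, IsExactDecomposition F κs κe LatticeTerm.meet

/-- An emd-noetherian form: a noetherian form with an exact meet decomposition. -/
class IsEmdNoetherianForm (F : B ⥤ C) : Prop extends IsNoetherianForm F where
  exact_meet : HasExactMeetDecomposition F

end Forms

namespace Forms

variable {C : Type u} [Category.{v} C]
variable {B : Type u₂} [Category.{v₂} B]

/-! ### Direct and inverse images -/

section Orean

variable (F : B ⥤ C) [hF : IsOrean F] {X Y Z : C}

theorem rel_id_iff_le {S T : Cluster F X} : Rel F (𝟙 X) S T ↔ S ≤ T := Iff.rfl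

variable {F} in
theorem Rel.mono {f : X ⟶ Y} {S S' : Cluster F X} {T T' : Cluster F Y} (hS : S ≤ S')
    (h : Rel F f S' T) (hT : T ≤ T') : Rel F f S T' := by
  simpa using (Rel.comp ((rel_id_iff_le F).2 hS) h).comp ((rel_id_iff_le F).2 hT)

theorem rel_iff_direct_le {f : X ⟶ Y} {S : Cluster F X} {T : Cluster F Y} :
    Rel F f S T ↔ direct F f S ≤ T :=
  ⟨fun h ↦ (isLeast_direct F f S).2 h, fun h ↦ Rel.mono le_rfl (isLeast_direct F f S).1 h⟩

theorem rel_iff_le_inverse {f : X ⟶ Y} {S : Cluster F X} {T : Cluster F Y} :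
    Rel F f S T ↔ S ≤ inverse F f T :=
  ⟨fun h ↦ (isGreatest_inverse F f T).2 h, fun h ↦ Rel.mono h (isGreatest_inverse F f T).1 le_rfl⟩

theorem gc_direct_inverse (f : X ⟶ Y) : GaloisConnection (direct F f) (inverse F f) :=
  fun _ _ ↦ (rel_iff_direct_le F).symm.trans (rel_iff_le_inverse F)

theorem direct_id (S : Cluster F X) : direct F (𝟙 X) S = S :=
  eq_of_forall_ge_iff fun T ↦ by rw [← rel_iff_direct_le, rel_id_iff_le]

theorem inverse_id (S : Cluster F X) : inverse F (𝟙 X) S = S :=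
  eq_of_forall_le_iff fun T ↦ by rw [← rel_iff_le_inverse, rel_id_iff_le]

theorem direct_comp (f : X ⟶ Y) (g : Y ⟶ Z) (S : Cluster F X) :
    direct F (f ≫ g) S = direct F g (direct F f S) := by
  refine eq_of_forall_ge_iff fun T ↦ ?_
  rw [← rel_iff_direct_le]
  constructor
  · intro h
    obtain ⟨R, h₁, h₂⟩ := hF.exists_mid f g S T h
    exact (rel_iff_direct_le F).1 (Rel.mono ((rel_iff_direct_le F).1 h₁) h₂ le_rfl)
  · exact fun h ↦ (isLeast_direct F f S).1.comp ((rel_iff_direct_le F).2 h)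

theorem inverse_comp (f : X ⟶ Y) (g : Y ⟶ Z) (T : Cluster F Z) :
    inverse F (f ≫ g) T = inverse F f (inverse F g T) :=
  eq_of_forall_le_iff fun S ↦ by
    rw [← gc_direct_inverse F, direct_comp, gc_direct_inverse F, gc_direct_inverse F]

theorem im_comp (f : X ⟶ Y) (g : Y ⟶ Z) : im F (f ≫ g) = direct F g (im F f) :=
  direct_comp F f g ⊤

theorem ker_comp (f : X ⟶ Y) (g : Y ⟶ Z) : ker F (f ≫ g) = inverse F f (ker F g) :=
  inverse_comp F f g ⊥

theorem im_id : im F (𝟙 X) = ⊤ := direct_id F ⊤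

theorem ker_id : ker F (𝟙 X) = ⊥ := inverse_id F ⊥

theorem im_comp_le (f : X ⟶ Y) (g : Y ⟶ Z) : im F (f ≫ g) ≤ im F g := by
  rw [im_comp]
  exact (gc_direct_inverse F g).monotone_l le_top

theorem ker_le_ker_comp (f : X ⟶ Y) (g : Y ⟶ Z) : ker F f ≤ ker F (f ≫ g) := by
  rw [ker_comp]
  exact (gc_direct_inverse F f).monotone_u bot_le

theorem ker_eq_top_iff (f : X ⟶ Y) : ker F f = ⊤ ↔ im F f = ⊥ := by
  rw [← top_le_iff, ← le_bot_iff]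
  exact (gc_direct_inverse F f ⊤ ⊥).symm

theorem ker_eq_bot_of_comp_eq_id {f : X ⟶ Y} {g : Y ⟶ X} (h : f ≫ g = 𝟙 X) : ker F f = ⊥ :=
  le_bot_iff.1 ((ker_le_ker_comp F f g).trans (by rw [h, ker_id]))

theorem im_eq_top_of_comp_eq_id {f : X ⟶ Y} {g : Y ⟶ X} (h : f ≫ g = 𝟙 X) : im F g = ⊤ :=
  top_le_iff.1 (le_trans (by rw [h, im_id]) (im_comp_le F f g))

theorem im_comp_eq_bot_iff (f : X ⟶ Y) (g : Y ⟶ Z) : im F (f ≫ g) = ⊥ ↔ im F f ≤ ker F g := by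
  rw [im_comp, ← le_bot_iff]
  exact gc_direct_inverse F g _ _

variable {F}

theorem IsEmbedding.isIso {m : X ⟶ Y} (hm : IsEmbedding F m ⊤) : IsIso m := by
  obtain ⟨u, hu, -⟩ := hm.2 (𝟙 Y) le_top
  exact ⟨u, (hm.2 m le_top).unique (by simp [hu]) (by simp), hu⟩

theorem IsQuotient.isIso {e : X ⟶ Y} (he : IsQuotient F e ⊥) : IsIso e := by
  obtain ⟨u, hu, -⟩ := he.2 (𝟙 X) bot_le
  exact ⟨u, hu, (he.2 e bot_le).unique (by simp [reassoc_of% hu]) (by simp)⟩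

variable (F)

/-- An object is trivial when its least and greatest clusters coincide. -/
def IsTrivial (X : C) : Prop := (⊥ : Cluster F X) = ⊤

variable {F}

theorem IsTrivial.eq (h : IsTrivial F X) (S T : Cluster F X) : S = T :=
  have := subsingleton_of_bot_eq_top h
  Subsingleton.elim S T

theorem IsTrivial.im_eq_bot (h : IsTrivial F X) (f : X ⟶ Y) : im F f = ⊥ :=
  (ker_eq_top_iff F f).1 (h.eq _ _)

end Orean

/-! ### Noetherian forms -/

section Noetherian

variable {F : B ⥤ C} [hF : IsNoetherianForm F] {X Y Z : C}

theorem IsEmbedding.ker_eq_bot {m : X ⟶ Y} {S : Cluster F Y} (hm : IsEmbedding F m S) :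
    ker F m = ⊥ := by
  obtain ⟨Z, e, n, he, hn, rfl⟩ := hF.factorization m
  obtain ⟨u, hu, -⟩ := hm.2 n (hn.1.trans hm.1).le
  rw [← he.1]
  exact ker_eq_bot_of_comp_eq_id F (g := u)
    ((hm.2 (e ≫ n) hm.1.le).unique (by simp [hu]) (by simp))

theorem IsQuotient.im_eq_top {e : X ⟶ Y} {S : Cluster F X} (he : IsQuotient F e S) :
    im F e = ⊤ := by
  obtain ⟨Z, d, m, hd, hm, rfl⟩ := hF.factorization e
  obtain ⟨u, hu, -⟩ := he.2 d (he.1.symm.trans hd.1.symm).le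
  rw [← hm.1]
  exact im_eq_top_of_comp_eq_id F (f := u)
    ((he.2 (d ≫ m) he.1.ge).unique (by simp [reassoc_of% hu]) (by simp))

theorem IsConormalCluster.exists_isEmbedding {S : Cluster F X} (hS : IsConormalCluster F S) :
    ∃ (M : C) (m : M ⟶ X), IsEmbedding F m S := by
  obtain ⟨W, f, rfl⟩ := hS
  obtain ⟨M, e, m, -, hm, -⟩ := hF.factorization f
  exact ⟨M, m, hm⟩

theorem IsNormalCluster.exists_isQuotient {S : Cluster F X} (hS : IsNormalCluster F S) :
    ∃ (Q : C) (e : X ⟶ Q), IsQuotient F e S := by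
  obtain ⟨W, f, rfl⟩ := hS
  obtain ⟨M, e, m, he, -, -⟩ := hF.factorization f
  exact ⟨M, e, he⟩

theorem IsEmbedding.isTrivial {m : X ⟶ Y} (hm : IsEmbedding F m ⊥) : IsTrivial F X := by
  rw [IsTrivial, ← hm.ker_eq_bot, ker_eq_top_iff, hm.1]

theorem IsQuotient.isTrivial {e : X ⟶ Y} (he : IsQuotient F e ⊤) : IsTrivial F Y := by
  rw [IsTrivial, ← he.im_eq_top, eq_comm, ← ker_eq_top_iff, he.1]

theorem IsTrivial.isIso (hX : IsTrivial F X) (hY : IsTrivial F Y) (f : X ⟶ Y) : IsIso f := by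
  obtain ⟨Z, e, m, he, hm, rfl⟩ := hF.factorization f
  rw [hX.eq (ker F _) ⊥] at he
  rw [hY.eq (im F _) ⊤] at hm
  have := he.isIso
  have := hm.isIso
  infer_instance

theorem isTrivial_of_isTerminal (hX : IsTerminal X)
    (h : IsNormalCluster F (⊤ : Cluster F X)) : IsTrivial F X := by
  obtain ⟨Q, e, he⟩ := h.exists_isQuotient
  rw [IsTrivial, ← he.1]
  exact (ker_eq_bot_of_comp_eq_id F (hX.hom_ext (e ≫ hX.from Q) (𝟙 X))).symm

theorem isTrivial_of_isInitial (hX : IsInitial X)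
    (h : IsConormalCluster F (⊥ : Cluster F X)) : IsTrivial F X := by
  obtain ⟨M, m, hm⟩ := h.exists_isEmbedding
  rw [IsTrivial, ← hm.1]
  exact im_eq_top_of_comp_eq_id F (hX.hom_ext (hX.to M ≫ m) (𝟙 X))

variable (F) in
theorem hasZeroObject_of_normal_top_of_conormal_bot [HasTerminal C] [HasInitial C]
    (hT : ∀ X : C, IsNormalCluster F (⊤ : Cluster F X))
    (hB : ∀ X : C, IsConormalCluster F (⊥ : Cluster F X)) : HasZeroObject C := by
  have h₁ := isTrivial_of_isTerminal terminalIsTerminal (hT (⊤_ C))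
  have h₀ := isTrivial_of_isInitial initialIsInitial (hB (⊥_ C))
  have := h₀.isIso h₁ (initial.to (⊤_ C))
  have hI : IsInitial (⊤_ C) := initialIsInitial.ofIso (asIso (initial.to (⊤_ C)))
  exact IsZero.hasZeroObject (X := ⊤_ C)
    ⟨fun Y ↦ ⟨⟨⟨hI.to Y⟩, fun _ ↦ hI.hom_ext _ _⟩⟩,
      fun Y ↦ ⟨⟨⟨terminal.from Y⟩, fun _ ↦ terminalIsTerminal.hom_ext _ _⟩⟩⟩

theorem isTrivial_of_isZero (hX : IsZero X) (h : IsNormalCluster F (⊤ : Cluster F X)) :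
    IsTrivial F X :=
  isTrivial_of_isTerminal hX.isTerminal h

theorem isConormalCluster_bot_of_isZero (hZ : IsZero Z)
    (h : IsNormalCluster F (⊤ : Cluster F Z)) (X : C) :
    IsConormalCluster F (⊥ : Cluster F X) :=
  ⟨Z, hZ.to_ X, ((isTrivial_of_isZero hZ h).im_eq_bot _).symm⟩

theorem IsTrivial.isZero (hX : IsTrivial F X) (hZ : IsZero Z)
    (h : IsNormalCluster F (⊤ : Cluster F Z)) : IsZero X :=
  have := hX.isIso (isTrivial_of_isZero hZ h) (hZ.from_ X)
  hZ.of_iso (asIso (hZ.from_ X))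

/-! ### Abelian categories from binormal noetherian forms -/

theorem im_eq_bot_iff [HasZeroObject C] [HasZeroMorphisms C] (hN : IsNormalForm F) (f : X ⟶ Y) :
    im F f = ⊥ ↔ f = 0 := by
  obtain ⟨O, hO⟩ := HasZeroObject.zero (C := C)
  constructor
  · intro h
    obtain ⟨Z, e, m, -, hm, rfl⟩ := hF.factorization f
    rw [h] at hm
    have hZ := hm.isTrivial.isZero hO (hN _ _)
    rw [hZ.eq_zero_of_src m, comp_zero]
  · rintro rfl
    rw [← zero_comp (X := X) (f := (0 : O ⟶ Y)), im_comp_eq_bot_iff,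
      (isTrivial_of_isZero hO (hN _ _)).eq (im F _) ⊥]
    exact bot_le

theorem ker_eq_top_iff_eq_zero [HasZeroObject C] [HasZeroMorphisms C] (hN : IsNormalForm F)
    (f : X ⟶ Y) : ker F f = ⊤ ↔ f = 0 := by
  rw [ker_eq_top_iff, im_eq_bot_iff hN]

theorem comp_eq_zero_iff [HasZeroObject C] [HasZeroMorphisms C] (hN : IsNormalForm F)
    (f : X ⟶ Y) (g : Y ⟶ Z) : f ≫ g = 0 ↔ im F f ≤ ker F g := by
  rw [← im_eq_bot_iff hN, im_comp_eq_bot_iff]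

/-- An embedding of the kernel cluster of a morphism is a kernel of this morphism. -/
noncomputable def IsEmbedding.isLimit [HasZeroObject C] [HasZeroMorphisms C] (hN : IsNormalForm F)
    {m : X ⟶ Y} {f : Y ⟶ Z} (hm : IsEmbedding F m (ker F f)) :
    IsLimit (KernelFork.ofι m ((comp_eq_zero_iff hN m f).2 hm.1.le)) :=
  KernelFork.IsLimit.ofι _ _
    (fun g hg ↦ (hm.2 g ((comp_eq_zero_iff hN g f).1 hg)).choose)
    (fun g hg ↦ (hm.2 g ((comp_eq_zero_iff hN g f).1 hg)).choose_spec.1)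
    (fun g hg u hu ↦ (hm.2 g ((comp_eq_zero_iff hN g f).1 hg)).choose_spec.2 u hu)

/-- A quotient of the image cluster of a morphism is a cokernel of this morphism. -/
noncomputable def IsQuotient.isColimit [HasZeroObject C] [HasZeroMorphisms C]
    (hN : IsNormalForm F) {e : Y ⟶ Z} {f : X ⟶ Y} (he : IsQuotient F e (im F f)) :
    IsColimit (CokernelCofork.ofπ e ((comp_eq_zero_iff hN f e).2 he.1.ge)) :=
  CokernelCofork.IsColimit.ofπ _ _
    (fun g hg ↦ (he.2 g ((comp_eq_zero_iff hN f g).1 hg)).choose)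
    (fun g hg ↦ (he.2 g ((comp_eq_zero_iff hN f g).1 hg)).choose_spec.1)
    (fun g hg u hu ↦ (he.2 g ((comp_eq_zero_iff hN f g).1 hg)).choose_spec.2 u hu)

theorem IsBinormalForm.isEmbedding_of_mono [HasZeroObject C] (hb : IsBinormalForm F) (m : X ⟶ Y)
    [Mono m] : IsEmbedding F m (im F m) := by
  have := HasZeroObject.zeroMorphismsOfZeroObject (C := C)
  obtain ⟨K, k, hk⟩ := (hb.2 _ (ker F m)).exists_isEmbedding
  have hk0 : k = 0 := by
    rw [← cancel_mono m, zero_comp, comp_eq_zero_iff hb.1]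
    exact hk.1.le
  have hker : ker F m = ⊥ := hk.1.symm.trans ((im_eq_bot_iff hb.1 k).2 hk0)
  obtain ⟨Z, e, n, he, hn, h⟩ := hF.factorization m
  rw [hker] at he
  have := he.isIso
  refine ⟨rfl, fun f hf ↦ ?_⟩
  obtain ⟨g, rfl, -⟩ := hn.2 f hf
  exact ⟨g ≫ inv e, by simp [← h], fun u hu ↦ (cancel_mono m).1 (hu.trans (by simp [← h]))⟩

theorem IsBinormalForm.isQuotient_of_epi [HasZeroObject C] (hb : IsBinormalForm F) (e : X ⟶ Y)
    [Epi e] : IsQuotient F e (ker F e) := by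
  have := HasZeroObject.zeroMorphismsOfZeroObject (C := C)
  obtain ⟨K, k, hk⟩ := (hb.1 _ (im F e)).exists_isQuotient
  have hk0 : k = 0 := by
    rw [← cancel_epi e, comp_zero, comp_eq_zero_iff hb.1]
    exact hk.1.ge
  have him : im F e = ⊤ := hk.1.symm.trans ((ker_eq_top_iff_eq_zero hb.1 k).2 hk0)
  obtain ⟨Z, d, n, hd, hn, h⟩ := hF.factorization e
  rw [him] at hn
  have := hn.isIso
  refine ⟨rfl, fun f hf ↦ ?_⟩
  obtain ⟨g, rfl, -⟩ := hd.2 f hf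
  exact ⟨inv n ≫ g, by simp [← h], fun u hu ↦ (cancel_epi e).1 (hu.trans (by simp [← h]))⟩

theorem IsBinormalForm.hasZeroObject [HasTerminal C] [HasInitial C] (hb : IsBinormalForm F) :
    HasZeroObject C :=
  hasZeroObject_of_normal_top_of_conormal_bot F (fun _ ↦ hb.1 _ _) (fun _ ↦ hb.2 _ _)

theorem IsBinormalForm.nonempty_abelian [HasFiniteProducts C] [HasFiniteCoproducts C]
    (hb : IsBinormalForm F) : Nonempty (Abelian C) := by
  have := hb.hasZeroObject
  have := HasZeroObject.zeroMorphismsOfZeroObject (C := C)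
  have : HasKernels C := ⟨fun f ↦ by
    obtain ⟨K, k, hk⟩ := (hb.2 _ (ker F f)).exists_isEmbedding
    exact ⟨_, hk.isLimit hb.1⟩⟩
  have : HasCokernels C := ⟨fun f ↦ by
    obtain ⟨K, k, hk⟩ := (hb.1 _ (im F f)).exists_isQuotient
    exact ⟨_, hk.isColimit hb.1⟩⟩
  have : IsNormalMonoCategory C := ⟨fun m _ ↦ by
    obtain ⟨Z, f, hf⟩ := hb.1 _ (im F m)
    have hm := hb.isEmbedding_of_mono m
    rw [hf] at hm
    exact ⟨⟨Z, f, _, hm.isLimit hb.1⟩⟩⟩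
  have : IsNormalEpiCategory C := ⟨fun e _ ↦ by
    obtain ⟨Z, f, hf⟩ := hb.2 _ (ker F e)
    have he := hb.isQuotient_of_epi e
    rw [hf] at he
    exact ⟨⟨Z, f, _, he.isColimit hb.1⟩⟩⟩
  let : NonPreadditiveAbelian C := {}
  exact ⟨NonPreadditiveAbelian.abelian C⟩

end Noetherian

end Forms

namespace Forms

variable {C : Type u} [Category.{v} C]
variable {A : Type u₁} [Category.{v₁} A] {B : Type u₂} [Category.{v₂} B]

/-! ### Operators and exact decompositions -/

namespace Operator

variable {F : A ⥤ C} {G : B ⥤ C} {X Y : C}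

theorem rel_app (τ : Operator F G) {f : X ⟶ Y} {S : Cluster F X} {T : Cluster F Y}
    (h : Rel F f S T) : Rel G f (τ.app S) (τ.app T) := by
  obtain ⟨τ, rfl⟩ := τ
  obtain ⟨φ, hφ⟩ := h
  exact ⟨τ.map φ, IsHomLift.of_fac' G f (τ.map φ) S.obj_eq T.obj_eq
    (IsHomLift.fac' (τ ⋙ G) f φ)⟩

theorem app_mono [IsForm F] [IsForm G] (τ : Operator F G) {S T : Cluster F X} (h : S ≤ T) :
    τ.app S ≤ τ.app T :=
  τ.rel_app h

instance isForm_closedForm {F : B ⥤ C} [hF : IsForm F] (κ : Operator F F) :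
    IsForm κ.closedForm where
  faithful := by
    have := hF.faithful
    exact inferInstanceAs (κ.IsClosed.ι ⋙ F).Faithful
  amnestic {S T} φ _ hφ := by
    have hφ' : F.IsHomLift (𝟙 (F.obj S.obj)) (κ.IsClosed.ι.map φ) :=
      IsHomLift.of_fac' F _ _ rfl (@IsHomLift.codomain_eq _ _ _ _ κ.closedForm _ _ _ _ _ φ hφ)
        (@IsHomLift.fac' _ _ _ _ κ.closedForm _ _ _ _ _ φ hφ)
    obtain ⟨h, e⟩ := hF.amnestic (κ.IsClosed.ι.map φ) hφ'
    obtain ⟨S, hS⟩ := S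
    obtain ⟨T, hT⟩ := T
    obtain rfl : S = T := h
    exact ⟨rfl, κ.IsClosed.ι.map_injective e⟩

section Inverse

variable (τ : Operator F G) (σ : Operator G F)

theorem rel_app_iff (hτσ : ∀ {X : C} (S : Cluster G X), τ.app (σ.app S) = S)
    {f : X ⟶ Y} {S : Cluster G X} {T : Cluster G Y} :
    Rel F f (σ.app S) (σ.app T) ↔ Rel G f S T :=
  ⟨fun h ↦ by simpa only [hτσ] using τ.rel_app h, σ.rel_app⟩

theorem isOrean_of_inverse [hF : IsOrean F] [hG : IsForm G]
    (hτσ : ∀ {X : C} (S : Cluster G X), τ.app (σ.app S) = S)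
    (hστ : ∀ {X : C} (S : Cluster F X), σ.app (τ.app S) = S) : IsOrean G := by
  have hrel {X Y : C} {f : X ⟶ Y} {S : Cluster G X} {T : Cluster G Y} :
      Rel G f S T ↔ Rel F f (σ.app S) (σ.app T) := (rel_app_iff τ σ hτσ).symm
  have hle {X : C} {S T : Cluster G X} : S ≤ T ↔ σ.app S ≤ σ.app T := hrel
  refine ⟨fun X ↦ ⟨τ.app ⊥, trivial, fun S _ ↦ ?_⟩, fun X ↦ ⟨τ.app ⊤, trivial, fun S _ ↦ ?_⟩,
    fun S T ↦ ⟨τ.app (σ.app S ⊔ σ.app T), ?_, fun U hU ↦ ?_⟩,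
    fun S T ↦ ⟨τ.app (σ.app S ⊓ σ.app T), ?_, fun U hU ↦ ?_⟩, fun f g R T h ↦ ?_,
    fun f S ↦ ⟨τ.app (direct F f (σ.app S)), ?_, fun T hT ↦ ?_⟩,
    fun f T ↦ ⟨τ.app (inverse F f (σ.app T)), ?_, fun S hS ↦ ?_⟩⟩
  · simp [hle, hστ]
  · simp [hle, hστ]
  · rintro _ (rfl | rfl) <;> simp [hle, hστ]
  · rw [hle, hστ]
    exact sup_le (hle.1 (hU (by simp))) (hle.1 (hU (by simp)))
  · rintro _ (rfl | rfl) <;> simp [hle, hστ]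
  · rw [hle, hστ]
    exact le_inf (hle.1 (hU (by simp))) (hle.1 (hU (by simp)))
  · obtain ⟨S, h₁, h₂⟩ := hF.exists_mid f g _ _ (hrel.1 h)
    exact ⟨τ.app S, by rwa [hrel, hστ], by rwa [hrel, hστ]⟩
  · rw [Set.mem_ofPred_eq, hrel, hστ, rel_iff_direct_le]
  · rw [hle, hστ, ← rel_iff_direct_le, ← hrel]
    exact hT
  · rw [Set.mem_ofPred_eq, hrel, hστ, rel_iff_le_inverse]
  · rw [hle, hστ, ← rel_iff_le_inverse, ← hrel]
    exact hS

theorem isBinormal_of_inverse [IsOrean F] [IsOrean G]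
    (hτσ : ∀ {X : C} (S : Cluster G X), τ.app (σ.app S) = S)
    (hστ : ∀ {X : C} (S : Cluster F X), σ.app (τ.app S) = S) : τ.IsBinormal := by
  have htop (X : C) : σ.app (⊤ : Cluster G X) = ⊤ :=
    top_le_iff.1 (by simpa only [hστ] using σ.app_mono (le_top : τ.app ⊤ ≤ ⊤))
  have hbot (X : C) : σ.app (⊥ : Cluster G X) = ⊥ :=
    le_bot_iff.1 (by simpa only [hστ] using σ.app_mono (bot_le : ⊥ ≤ τ.app ⊥))
  constructor
  · intro X Y f
    refine eq_of_forall_le_iff fun S ↦ ?_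
    rw [ker, ker, ← rel_iff_le_inverse, ← rel_app_iff τ σ hτσ, hbot, rel_iff_le_inverse,
      ← rel_id_iff_le, ← rel_app_iff τ σ hτσ, hστ, rel_id_iff_le]
  · intro X Y f
    refine eq_of_forall_ge_iff fun S ↦ ?_
    rw [im, im, ← rel_iff_direct_le, ← rel_app_iff τ σ hτσ, htop, rel_iff_direct_le,
      ← rel_id_iff_le, ← rel_app_iff τ σ hτσ, hστ, rel_id_iff_le]

end Inverse

/-- The identity operator. -/
def refl (F : B ⥤ C) : Operator F F := ⟨𝟭 B, rfl⟩

theorem isIdempotent_refl (F : B ⥤ C) : (refl F).IsIdempotent := rfl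

end Operator

section Decomposition

variable {F : B ⥤ C}

/-- In a binormal form, the identity operators form an exact decomposition. -/
theorem IsBinormalForm.isExactDecomposition_refl [hF : IsOrean F] (hb : IsBinormalForm F)
    (d : LatticeTerm) (hd : ∀ {X : C} (S : Cluster F X), S = d.eval S S) :
    IsExactDecomposition F (.refl F) (.refl F) d := by
  have hid := Operator.isIdempotent_refl F
  have h₁ {X : C} (S : Cluster (Operator.refl F).closedForm X) :
      ((Operator.refl F).projection hid).app ((Operator.refl F).inclusion.app S) = S := rfl
  have h₂ {X : C} (S : Cluster F X) :
      (Operator.refl F).inclusion.app (((Operator.refl F).projection hid).app S) = S := rfl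
  have hO := Operator.isOrean_of_inverse _ _ h₁ h₂
  have hp := Operator.isBinormal_of_inverse _ _ h₁ h₂
  have hi := Operator.isBinormal_of_inverse _ _ h₂ h₁
  have hr : (Operator.refl (Operator.refl F).closedForm).IsBinormal :=
    Operator.isBinormal_of_inverse _ (Operator.refl _) (fun _ ↦ rfl) (fun _ ↦ rfl)
  have hN : IsNormalForm (Operator.refl F).closedForm := fun X S ↦ by
    obtain ⟨Y, f, hf⟩ := hb.1 X ((Operator.refl F).inclusion.app S)
    exact ⟨Y, f, by rw [← hp.1, ← hf, h₁]⟩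
  have hC : IsConormalForm (Operator.refl F).closedForm := fun X S ↦ by
    obtain ⟨Y, f, hf⟩ := hb.2 X ((Operator.refl F).inclusion.app S)
    exact ⟨Y, f, by rw [← hp.2, ← hf, h₁]⟩
  exact
    { idem_s := hid, idem_e := hid, orean_s := hO, orean_e := hO, conormal_s := hC,
      normal_e := hN, eq_eval := hd, binormal_s := hp, binormal_e := hp,
      semiexact := ⟨hC, hN, ⟨_, hr.2⟩, ⟨_, hr.1⟩⟩, inclusion_s := hi.2, inclusion_e := hi.1 }

theorem IsBinormalForm.hasExactJoinDecomposition [IsOrean F] (hb : IsBinormalForm F) :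
    HasExactJoinDecomposition F :=
  ⟨_, _, hb.isExactDecomposition_refl .join fun S ↦ (sup_idem S).symm⟩

theorem IsBinormalForm.hasExactMeetDecomposition [IsOrean F] (hb : IsBinormalForm F) :
    HasExactMeetDecomposition F :=
  ⟨_, _, hb.isExactDecomposition_refl .meet fun S ↦ (inf_idem S).symm⟩

namespace IsExactDecomposition

variable [IsOrean F] {κs κe : Operator F F} {d : LatticeTerm} {X Y : C}

theorem isConormalCluster_app (h : IsExactDecomposition F κs κe d)
    (S : Cluster F X) : IsConormalCluster F (κs.app S) := by
  have := h.orean_s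
  obtain ⟨W, f, hf⟩ := h.conormal_s X ((κs.projection h.idem_s).app S)
  exact ⟨W, f, by rw [← h.inclusion_s, ← hf]; rfl⟩

theorem isNormalCluster_app (h : IsExactDecomposition F κs κe d)
    (S : Cluster F X) : IsNormalCluster F (κe.app S) := by
  have := h.orean_e
  obtain ⟨W, f, hf⟩ := h.normal_e X ((κe.projection h.idem_e).app S)
  exact ⟨W, f, by rw [← h.inclusion_e, ← hf]; rfl⟩

theorem app_ker_le (h : IsExactDecomposition F κs κe d) (f : X ⟶ Y)
    (hY : IsConormalCluster F (⊥ : Cluster F Y)) :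
    κs.app (ker F f) ≤ ker F f := by
  have := h.orean_s
  obtain ⟨W, g, hg⟩ := hY
  have hbot : κs.inclusion.app (⊥ : Cluster κs.closedForm Y) = ⊥ := by
    rw [← le_bot_iff, hg, ← h.inclusion_s]
    exact κs.inclusion.app_mono bot_le
  have e : κs.app (ker F f) = κs.inclusion.app (ker κs.closedForm f) :=
    congrArg κs.inclusion.app (h.binormal_s.1 f)
  rw [e]
  refine (rel_iff_le_inverse F).1 ?_
  rw [← hbot]
  exact κs.inclusion.rel_app (isGreatest_inverse κs.closedForm f ⊥).1

theorem le_app_im (h : IsExactDecomposition F κs κe d) (f : X ⟶ Y)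
    (hX : IsNormalCluster F (⊤ : Cluster F X)) :
    im F f ≤ κe.app (im F f) := by
  have := h.orean_e
  obtain ⟨W, g, hg⟩ := hX
  have htop : κe.inclusion.app (⊤ : Cluster κe.closedForm X) = ⊤ := by
    rw [← top_le_iff, hg, ← h.inclusion_e]
    exact κe.inclusion.app_mono le_top
  have e : κe.app (im F f) = κe.inclusion.app (im κe.closedForm f) :=
    congrArg κe.inclusion.app (h.binormal_e.2 f)
  rw [e]
  refine (rel_iff_direct_le F).1 ?_
  rw [← htop]
  exact κe.inclusion.rel_app (isLeast_direct κe.closedForm f ⊤).1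

end IsExactDecomposition

section JoinMeet

variable [IsOrean F] {κs κe : Operator F F} {X : C}

theorem IsExactDecomposition.isNormalCluster_top
    (h : IsExactDecomposition F κs κe .meet) : IsNormalCluster F (⊤ : Cluster F X) := by
  have e : κe.app ⊤ = (⊤ : Cluster F X) :=
    top_le_iff.1 (le_of_eq_of_le (h.eq_eval ⊤) inf_le_right)
  rw [← e]
  exact h.isNormalCluster_app ⊤

theorem IsExactDecomposition.isConormalCluster_of_isNormalCluster
    (h : IsExactDecomposition F κs κe .meet)
    (hB : ∀ Y : C, IsConormalCluster F (⊥ : Cluster F Y)) {S : Cluster F X}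
    (hS : IsNormalCluster F S) : IsConormalCluster F S := by
  obtain ⟨Y, f, rfl⟩ := hS
  have e : κs.app (ker F f) = ker F f :=
    (h.app_ker_le f (hB Y)).antisymm (le_of_eq_of_le (h.eq_eval _) inf_le_left)
  rw [← e]
  exact h.isConormalCluster_app _

theorem IsExactDecomposition.isConormalCluster_bot
    (h : IsExactDecomposition F κs κe .join) : IsConormalCluster F (⊥ : Cluster F X) := by
  have e : κs.app ⊥ = (⊥ : Cluster F X) :=
    le_bot_iff.1 (le_of_le_of_eq le_sup_left (h.eq_eval ⊥).symm)
  rw [← e]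
  exact h.isConormalCluster_app ⊥

theorem IsExactDecomposition.isNormalCluster_of_isConormalCluster
    (h : IsExactDecomposition F κs κe .join)
    (hT : ∀ Y : C, IsNormalCluster F (⊤ : Cluster F Y)) {S : Cluster F X}
    (hS : IsConormalCluster F S) : IsNormalCluster F S := by
  obtain ⟨Y, f, rfl⟩ := hS
  have e : κe.app (im F f) = im F f :=
    (le_of_le_of_eq le_sup_right (h.eq_eval _).symm).antisymm (h.le_app_im f (hT Y))
  rw [← e]
  exact h.isNormalCluster_app _

end JoinMeet

/-- An emd-noetherian form with an exact join decomposition is binormal. -/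
theorem IsEmdNoetherianForm.isBinormalForm_of_join [hF : IsEmdNoetherianForm F]
    (hj : HasExactJoinDecomposition F) : IsBinormalForm F := by
  obtain ⟨κs, κe, hm⟩ := hF.exact_meet
  obtain ⟨κs', κe', hj⟩ := hj
  have hT (X : C) : IsNormalCluster F (⊤ : Cluster F X) := hm.isNormalCluster_top
  have hB (X : C) : IsConormalCluster F (⊥ : Cluster F X) := hj.isConormalCluster_bot
  have hC (X : C) (S : Cluster F X) : IsConormalCluster F S := by
    rw [hm.eq_eval S]
    exact hF.conormal_inf _ _ (hm.isConormalCluster_app S)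
      (hm.isConormalCluster_of_isNormalCluster hB (hm.isNormalCluster_app S))
  exact ⟨fun X S ↦ hj.isNormalCluster_of_isConormalCluster hT (hC X S), hC⟩

/-- A normal emd-noetherian form over a pointed category is binormal. -/
theorem IsEmdNoetherianForm.isBinormalForm_of_isNormalForm [hF : IsEmdNoetherianForm F]
    [HasZeroObject C] (hN : IsNormalForm F) : IsBinormalForm F := by
  obtain ⟨κs, κe, hm⟩ := hF.exact_meet
  obtain ⟨O, hO⟩ := HasZeroObject.zero (C := C)
  exact ⟨hN, fun X S ↦ hm.isConormalCluster_of_isNormalCluster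
    (isConormalCluster_bot_of_isZero hO (hN _ _)) (hN X S)⟩

end Decomposition

end Forms

namespace CategoryTheory.Abelian

variable {C : Type u} [Category.{v} C] [Abelian C] {W X Y : C}

/-! ### Subobjects in abelian categories -/

theorem subobject_factors_iff (P : Subobject X) (g : W ⟶ X) :
    P.Factors g ↔ g ≫ cokernel.π P.arrow = 0 := by
  constructor
  · intro h
    rw [← P.factorThru_arrow g h, Category.assoc, cokernel.condition, comp_zero]
  · intro h
    exact (P.factors_iff g).2 ⟨monoLift P.arrow g h, monoLift_comp P.arrow g h⟩

theorem subobject_factors_of_epi_comp {V : C} (P : Subobject X) (p : V ⟶ W) [Epi p] (g : W ⟶ X)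
    (h : P.Factors (p ≫ g)) : P.Factors g := by
  rw [subobject_factors_iff] at h ⊢
  rw [← cancel_epi p, comp_zero, ← h, Category.assoc]

theorem le_pullback_iff (f : X ⟶ Y) (S : Subobject X) (T : Subobject Y) :
    S ≤ (Subobject.pullback f).obj T ↔ T.Factors (S.arrow ≫ f) := by
  rw [← Limits.pullback_factors_iff]
  exact ⟨fun h ↦ Subobject.factors_of_le _ h S.factors_self, Subobject.le_of_factors⟩

theorem gc_image_pullback (f : X ⟶ Y) :
    GaloisConnection (fun S : Subobject X ↦ imageSubobject (S.arrow ≫ f))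
      (fun T ↦ (Subobject.pullback f).obj T) := by
  intro S T
  rw [le_pullback_iff]
  constructor
  · intro h
    refine Subobject.factors_of_le _ h ?_
    simpa using imageSubobject_factors_comp_self (f := S.arrow ≫ f) (𝟙 _)
  · intro h
    exact imageSubobject_le _ (T.factorThru _ h) (T.factorThru_arrow _ h)

theorem pullback_bot (f : X ⟶ Y) :
    (Subobject.pullback f).obj (⊥ : Subobject Y) = kernelSubobject f := by
  refine eq_of_forall_le_iff fun S ↦ ?_
  rw [le_pullback_iff, Subobject.bot_factors_iff_zero]
  exact ⟨le_kernelSubobject f S, fun h ↦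
    (kernelSubobject_factors_iff f S.arrow).1 (Subobject.factors_of_le _ h S.factors_self)⟩

theorem image_top_arrow_comp (f : X ⟶ Y) :
    imageSubobject ((⊤ : Subobject X).arrow ≫ f) = imageSubobject f :=
  imageSubobject_iso_comp _ f

theorem image_comp_factors (p : W ⟶ X) (f : X ⟶ Y) {P : Subobject X} (h : P.Factors p) :
    (imageSubobject (P.arrow ≫ f)).Factors (p ≫ f) := by
  rw [← P.factorThru_arrow p h, Category.assoc]
  exact imageSubobject_factors_comp_self (f := P.arrow ≫ f) _

theorem pullback_image (f : X ⟶ Y) (S : Subobject X) :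
    (Subobject.pullback f).obj (imageSubobject (S.arrow ≫ f)) = S ⊔ kernelSubobject f := by
  apply le_antisymm
  · apply Subobject.le_of_factors
    set P := (Subobject.pullback f).obj (imageSubobject (S.arrow ≫ f))
    have hP := (le_pullback_iff f P _).1 le_rfl
    let a := factorThruImageSubobject (S.arrow ≫ f)
    let r := Subobject.factorThru _ _ hP
    have hr : r ≫ (imageSubobject (S.arrow ≫ f)).arrow = P.arrow ≫ f :=
      Subobject.factorThru_arrow _ _ hP
    have hk : (kernelSubobject f).Factors
        (pullback.snd a r ≫ P.arrow + -(pullback.fst a r ≫ S.arrow)) := by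
      rw [kernelSubobject_factors_iff, Preadditive.add_comp, Preadditive.neg_comp,
        Category.assoc, ← hr, ← pullback.condition_assoc, imageSubobject_arrow_comp,
        Category.assoc, add_neg_cancel]
    refine subobject_factors_of_epi_comp _ (pullback.snd a r) _ ?_
    refine Subobject.factors_left_of_factors_add _ (-(pullback.fst a r ≫ S.arrow))
      (Subobject.sup_factors_of_factors_right hk) ?_
    rw [← Preadditive.neg_comp]
    exact Subobject.sup_factors_of_factors_left (Subobject.factors_comp_arrow _)
  · refine sup_le ((gc_image_pullback f).le_u_l S) ?_
    rw [← pullback_bot]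
    exact (gc_image_pullback f).monotone_u bot_le

theorem image_pullback (f : X ⟶ Y) (T : Subobject Y) :
    imageSubobject (((Subobject.pullback f).obj T).arrow ≫ f) = T ⊓ imageSubobject f := by
  apply le_antisymm
  · refine le_inf ((gc_image_pullback f).l_u_le T) ?_
    rw [← image_top_arrow_comp f]
    exact (gc_image_pullback f).monotone_l le_top
  · apply Subobject.le_of_factors
    set R := T ⊓ imageSubobject f
    have hT : T.Factors R.arrow := Subobject.inf_arrow_factors_left _ _
    have hI : (imageSubobject f).Factors R.arrow := Subobject.inf_arrow_factors_right _ _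
    let a := factorThruImageSubobject f
    let r := Subobject.factorThru _ _ hI
    have hr : r ≫ (imageSubobject f).arrow = R.arrow := Subobject.factorThru_arrow _ _ hI
    have e : pullback.snd a r ≫ R.arrow = pullback.fst a r ≫ f := by
      rw [← hr, ← pullback.condition_assoc, imageSubobject_arrow_comp]
    refine subobject_factors_of_epi_comp _ (pullback.snd a r) _ ?_
    rw [e]
    apply image_comp_factors
    rw [Limits.pullback_factors_iff, ← e]
    exact Subobject.factors_of_factors_right _ hT

end CategoryTheory.Abelian

namespace Forms

open CategoryTheory.Abelian

/-! ### The form of subobjects of an abelian category -/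

/-- An object of a category together with a subobject. -/
structure SubobjectPair (C : Type u) [Category.{v} C] : Type (max u v w) where
  base : C
  sub : Subobject base

namespace SubobjectPair

variable {C : Type u} [Category.{v} C] [Abelian C]

/-- A morphism of pairs is a morphism of the base objects which maps the first subobject into the
second one. -/
@[ext]
structure Hom (S T : SubobjectPair.{v, u, w} C) : Type (max v t) where
  hom : S.base ⟶ T.base
  le : S.sub ≤ (Subobject.pullback hom).obj T.sub

instance category : Category.{max v t} (SubobjectPair.{v, u, w} C) where
  Hom S T := Hom.{v, u, w, t} S T
  id S := ⟨𝟙 _, by rw [Subobject.pullback_id]⟩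
  comp {S T U} f g := ⟨f.hom ≫ g.hom, by
    rw [Subobject.pullback_comp]
    exact f.le.trans ((gc_image_pullback f.hom).monotone_u g.le)⟩
  id_comp _ := Hom.ext (Category.id_comp _)
  comp_id _ := Hom.ext (Category.comp_id _)
  assoc _ _ _ := Hom.ext (Category.assoc _ _ _)

variable (C) in
/-- The form of subobjects, which forgets the subobject. -/
def form : SubobjectPair.{v, u, w} C ⥤ C where
  obj S := S.base
  map f := Hom.hom.{v, u, w, t} f

instance isForm_form : IsForm (form.{v, u, w, t} C) where
  faithful := ⟨fun h ↦ Hom.ext h⟩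
  amnestic {S T} φ _ hφ := by
    have hψ : (form.{v, u, w, t} C).IsHomLift
        (𝟙 ((form.{v, u, w, t} C).obj S)) (inv φ) := inferInstance
    obtain ⟨X, S⟩ := S
    obtain ⟨Y, T⟩ := T
    obtain rfl : Y = X :=
      @IsHomLift.codomain_eq _ _ _ _ (form.{v, u, w, t} C) _ _ _ _ _ φ hφ
    have e₁ : Hom.hom.{v, u, w, t} φ = 𝟙 Y :=
      (@IsHomLift.eq_of_isHomLift _ _ _ _ (form.{v, u, w, t} C) ⟨Y, S⟩ ⟨Y, T⟩ (𝟙 Y) φ hφ).symm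
    have e₂ : Hom.hom.{v, u, w, t} (inv φ) = 𝟙 Y :=
      (@IsHomLift.eq_of_isHomLift _ _ _ _ (form.{v, u, w, t} C) ⟨Y, T⟩ ⟨Y, S⟩ (𝟙 Y) (inv φ) hψ).symm
    have h₁ := Hom.le.{v, u, w, t} φ
    have h₂ := Hom.le.{v, u, w, t} (inv φ)
    rw [e₁, Subobject.pullback_id] at h₁
    rw [e₂, Subobject.pullback_id] at h₂
    obtain rfl : S = T := le_antisymm h₁ h₂
    exact ⟨rfl, Hom.ext e₁⟩

variable {X Y Z : C}

/-- The cluster given by a subobject. -/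
def cluster (S : Subobject X) : Cluster (form.{v, u, w, t} C) X := ⟨⟨X, S⟩, rfl⟩

theorem cluster_surjective :
    Function.Surjective (cluster : Subobject X → Cluster (form.{v, u, w, t} C) X) := by
  rintro ⟨⟨Y, S⟩, h⟩
  obtain rfl : Y = X := h
  exact ⟨S, rfl⟩

theorem rel_cluster_iff {f : X ⟶ Y} {S : Subobject X} {T : Subobject Y} :
    Rel (form.{v, u, w, t} C) f (cluster S) (cluster T) ↔ S ≤ (Subobject.pullback f).obj T := by
  constructor
  · rintro ⟨φ, hφ⟩
    have e : f = Hom.hom.{v, u, w, t} φ :=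
      @IsHomLift.eq_of_isHomLift _ _ _ _ (form.{v, u, w, t} C) ⟨X, S⟩ ⟨Y, T⟩ f φ hφ
    rw [e]
    exact Hom.le.{v, u, w, t} φ
  · intro h
    let φ : (⟨X, S⟩ : SubobjectPair.{v, u, w} C) ⟶ ⟨Y, T⟩ := Hom.mk.{v, u, w, t} f h
    exact ⟨φ, IsHomLift.map (form.{v, u, w, t} C) φ⟩

/-- Clusters of the form of subobjects are subobjects. -/
noncomputable def clusterIso (X : C) : Subobject X ≃o Cluster (form.{v, u, w, t} C) X where
  toEquiv := Equiv.ofBijective cluster ⟨fun S T h ↦ by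
    have h₁ := rel_cluster_iff.1 h.le
    have h₂ := rel_cluster_iff.1 h.ge
    rw [Subobject.pullback_id] at h₁ h₂
    exact le_antisymm h₁ h₂, cluster_surjective⟩
  map_rel_iff' {S T} := by
    refine rel_cluster_iff.trans ?_
    rw [Subobject.pullback_id]

theorem rel_clusterIso_iff {f : X ⟶ Y} {S : Subobject X} {T : Subobject Y} :
    Rel (form.{v, u, w, t} C) f (clusterIso X S) (clusterIso Y T) ↔
      S ≤ (Subobject.pullback f).obj T :=
  rel_cluster_iff

instance isOrean_form : IsOrean (form.{v, u, w, t} C) where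
  exists_bot X := ⟨clusterIso X ⊥, trivial, (clusterIso X).surjective.forall.2 fun S _ ↦ by simp⟩
  exists_top X := ⟨clusterIso X ⊤, trivial, (clusterIso X).surjective.forall.2 fun S _ ↦ by simp⟩
  exists_sup {X} := (clusterIso X).surjective.forall₂.2 fun S T ↦
    ⟨clusterIso X (S ⊔ T), by rintro _ (rfl | rfl) <;> simp,
      (clusterIso X).surjective.forall.2 fun U hU ↦ by
        simpa using And.intro (hU (Set.mem_insert _ _)) (hU (Set.mem_insert_of_mem _ rfl))⟩
  exists_inf {X} := (clusterIso X).surjective.forall₂.2 fun S T ↦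
    ⟨clusterIso X (S ⊓ T), by rintro _ (rfl | rfl) <;> simp,
      (clusterIso X).surjective.forall.2 fun U hU ↦ by
        simpa using And.intro (hU (Set.mem_insert _ _)) (hU (Set.mem_insert_of_mem _ rfl))⟩
  exists_mid {X Y Z} f g := (clusterIso X).surjective.forall.2 fun R ↦
    (clusterIso Z).surjective.forall.2 fun T h ↦ by
      rw [rel_clusterIso_iff, Subobject.pullback_comp] at h
      exact ⟨clusterIso Y ((Subobject.pullback g).obj T), rel_clusterIso_iff.2 h,
        rel_clusterIso_iff.2 le_rfl⟩
  exists_direct {X Y} f := (clusterIso X).surjective.forall.2 fun S ↦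
    ⟨clusterIso Y (imageSubobject (S.arrow ≫ f)),
      rel_clusterIso_iff.2 ((gc_image_pullback f).le_u_l S),
      (clusterIso Y).surjective.forall.2 fun T h ↦
        (clusterIso Y).le_iff_le.2 ((gc_image_pullback f S T).2 (rel_clusterIso_iff.1 h))⟩
  exists_inverse {X Y} f := (clusterIso Y).surjective.forall.2 fun T ↦
    ⟨clusterIso X ((Subobject.pullback f).obj T), rel_clusterIso_iff.2 le_rfl,
      (clusterIso X).surjective.forall.2 fun S h ↦
        (clusterIso X).le_iff_le.2 (rel_clusterIso_iff.1 h)⟩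

theorem direct_clusterIso (f : X ⟶ Y) (S : Subobject X) :
    direct (form.{v, u, w, t} C) f (clusterIso X S) =
      clusterIso Y (imageSubobject (S.arrow ≫ f)) :=
  eq_of_forall_ge_iff <| (clusterIso Y).surjective.forall.2 fun T ↦ by
    rw [← rel_iff_direct_le, rel_clusterIso_iff, (clusterIso Y).le_iff_le]
    exact (gc_image_pullback f S T).symm

theorem inverse_clusterIso (f : X ⟶ Y) (T : Subobject Y) :
    inverse (form.{v, u, w, t} C) f (clusterIso Y T) =
      clusterIso X ((Subobject.pullback f).obj T) :=
  eq_of_forall_le_iff <| (clusterIso X).surjective.forall.2 fun S ↦ by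
    rw [← rel_iff_le_inverse, rel_clusterIso_iff, (clusterIso X).le_iff_le]

theorem im_form (f : X ⟶ Y) :
    im (form.{v, u, w, t} C) f = clusterIso Y (imageSubobject f) := by
  rw [im, ← (clusterIso X).map_top, direct_clusterIso, image_top_arrow_comp]

theorem ker_form (f : X ⟶ Y) :
    ker (form.{v, u, w, t} C) f = clusterIso X (kernelSubobject f) := by
  rw [ker, ← (clusterIso Y).map_bot, inverse_clusterIso, pullback_bot]

theorem isBinormalForm_form : IsBinormalForm (form.{v, u, w, t} C) := by
  constructor
  · refine fun X ↦ (clusterIso X).surjective.forall.2 fun S ↦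
      ⟨_, cokernel.π S.arrow, ?_⟩
    rw [ker_form]
    refine congrArg _ (le_antisymm (le_kernelSubobject _ _ (cokernel.condition _)) ?_)
    apply Subobject.le_of_factors
    rw [subobject_factors_iff, kernelSubobject_arrow_comp]
  · refine fun X ↦ (clusterIso X).surjective.forall.2 fun S ↦ ⟨_, S.arrow, ?_⟩
    rw [im_form, imageSubobject_mono, Subobject.mk_arrow]

theorem isEmbedding_form_of_mono (m : X ⟶ Y) [Mono m] :
    IsEmbedding (form.{v, u, w, t} C) m (im _ m) := by
  refine ⟨rfl, fun f hf ↦ ?_⟩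
  rw [im_form, im_form, (clusterIso Y).le_iff_le, imageSubobject_mono m] at hf
  have h : (Subobject.mk m).Factors f := Subobject.factors_of_le _ hf
    (by simpa using imageSubobject_factors_comp_self (f := f) (𝟙 _))
  obtain ⟨g, hg⟩ := (Subobject.mk_factors_iff m f).1 h
  exact ⟨g, hg, fun u hu ↦ (cancel_mono m).1 (hu.trans hg.symm)⟩

theorem isQuotient_form_of_epi (e : X ⟶ Y) [Epi e] :
    IsQuotient (form.{v, u, w, t} C) e (ker _ e) := by
  refine ⟨rfl, fun f hf ↦ ?_⟩
  rw [ker_form, ker_form, (clusterIso X).le_iff_le] at hf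
  have h : kernel.ι e ≫ f = 0 := (kernelSubobject_factors_iff f _).1
    (Subobject.factors_of_le _ hf (kernelSubobject_factors e _ (kernel.condition e)))
  exact ⟨epiDesc e f h, comp_epiDesc e f h,
    fun u hu ↦ (cancel_epi e).1 (hu.trans (comp_epiDesc e f h).symm)⟩

instance isNoetherianForm_form : IsNoetherianForm (form.{v, u, w, t} C) where
  inverse_direct {X Y} f := (clusterIso X).surjective.forall.2 fun S ↦ by
    rw [direct_clusterIso, inverse_clusterIso, ker_form, ← (clusterIso X).map_sup, pullback_image]
  direct_inverse {X Y} f := (clusterIso Y).surjective.forall.2 fun T ↦ by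
    rw [inverse_clusterIso, direct_clusterIso, im_form, ← (clusterIso Y).map_inf, image_pullback]
  factorization {X Y} f := by
    have hf := imageSubobject_arrow_comp f
    have hm := isEmbedding_form_of_mono.{v, u, w, t} (imageSubobject f).arrow
    have he := isQuotient_form_of_epi.{v, u, w, t} (factorThruImageSubobject f)
    have him : im (form.{v, u, w, t} C) (imageSubobject f).arrow = im _ f := by
      rw [im_form, im_form, imageSubobject_mono, Subobject.mk_arrow]
    have hker : ker (form.{v, u, w, t} C) (factorThruImageSubobject f) = ker _ f := by
      rw [ker_form, ker_form]
      conv_rhs => rw [← hf]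
      rw [kernelSubobject_comp_mono]
    rw [him] at hm
    rw [hker] at he
    exact ⟨_, _, _, he, hm, hf⟩
  normal_sup S T _ _ := isBinormalForm_form.1 _ _
  conormal_inf S T _ _ := isBinormalForm_form.2 _ _

end SubobjectPair

end Forms

theorem mainTheorem6 (C : Type u) [Category.{v} C] [HasFiniteProducts C]
    [HasFiniteCoproducts C] :
    List.TFAE [
      (∃ (B : Type (max u v w)) (_ : Category.{max v t} B) (F : B ⥤ C)
        (_ : Forms.IsNoetherianForm F), Forms.IsBinormalForm F),
      (∃ (B : Type (max u v w)) (_ : Category.{max v t} B) (F : B ⥤ C)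
        (_ : Forms.IsNoetherianForm F), Forms.IsBinormalForm F ∧ Forms.HasExactDecomposition F),
      (∃ (B : Type (max u v w)) (_ : Category.{max v t} B) (F : B ⥤ C)
        (_ : Forms.IsEmdNoetherianForm F), Forms.HasExactJoinDecomposition F),
      (HasZeroObject C ∧ ∃ (B : Type (max u v w)) (_ : Category.{max v t} B) (F : B ⥤ C)
        (_ : Forms.IsEmdNoetherianForm F), Forms.IsNormalForm F),
      Nonempty (Abelian C)] := by
  tfae_have 1 → 2 := by
    rintro ⟨B, _, F, hF, hb⟩
    obtain ⟨κs, κe, h⟩ := hb.hasExactJoinDecomposition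
    exact ⟨B, _, F, hF, hb, κs, κe, _, h⟩
  tfae_have 2 → 1 := by
    rintro ⟨B, _, F, hF, hb, -⟩
    exact ⟨B, _, F, hF, hb⟩
  tfae_have 1 → 3 := by
    rintro ⟨B, _, F, hF, hb⟩
    exact ⟨B, _, F, ⟨hb.hasExactMeetDecomposition⟩, hb.hasExactJoinDecomposition⟩
  tfae_have 3 → 1 := by
    rintro ⟨B, _, F, hF, hj⟩
    exact ⟨B, _, F, inferInstance, hF.isBinormalForm_of_join hj⟩
  tfae_have 1 → 4 := by
    rintro ⟨B, _, F, hF, hb⟩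
    exact ⟨hb.hasZeroObject, B, _, F, ⟨hb.hasExactMeetDecomposition⟩, hb.1⟩
  tfae_have 4 → 1 := by
    rintro ⟨_, B, _, F, hF, hN⟩
    exact ⟨B, _, F, inferInstance, hF.isBinormalForm_of_isNormalForm hN⟩
  tfae_have 1 → 5 := by
    rintro ⟨B, _, F, hF, hb⟩
    exact hb.nonempty_abelian
  tfae_have 5 → 1 := by
    rintro ⟨_⟩
    exact ⟨_, _, _, Forms.SubobjectPair.isNoetherianForm_form.{v, u, w, t},
      Forms.SubobjectPair.isBinormalForm_form.{v, u, w, t}⟩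
  tfae_finish
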